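/- Let $|0\rangle,|1\rangle,|2\rangle$ be the standard basis of $\mathbb{C}^3$, and put $|\eta_\pm\rangle=(|0\rangle\pm|1\rangle)/\sqrt2$ and $|\xi_\pm\rangle=(|1\rangle\pm|2\rangle)/\sqrt2$. Let $\mathbb{B}_{II}(3,3)\subset(\mathbb{C}^3)^{\otimes 3}$ be the family of the $27$ product states $$|0\rangle|\eta_\pm\rangle|\xi_\pm\rangle,\quad |\eta_\pm\rangle|2\rangle|\xi_\pm\rangle,\quad |2\rangle|\xi_\pm\rangle|\eta_\pm\rangle,\quad |\eta_\pm\rangle|\xi_\pm\rangle|0\rangle,\quad |\xi_\pm\rangle|0\rangle|\eta_\pm\rangle,\quad |\xi_\pm\rangle|\eta_\pm\rangle|2\rangle,\quad |k\rangle|k\rangle|k\rangle\ (k=0,1,2),$$ where the two signs in each of the first six expressions are chosen independently. Then $\mathbb{B}_{II}(3,3)$ is a genuinely nonlocal product basis of Type II, that is: (1) it is an orthonormal basis of $(\mathbb{C}^3)^{\otimes3}$ consisting of product vectors; (2) (genuine nonlocality) across each of the three bipartitions $A|BC$, $B|CA$, $C|AB$, the $27$ states cannot be perfectly distinguished by local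 operations and classical communication (LOCC) between the two sides, with any finite number of rounds or with an infinite number of rounds in which the probability of identifying each state tends to $1$ along the finite initial parts of one protocol; (3) (Type II) the basis is locally irreducible when all three parties are separated: no measurement by a single party that keeps the $27$ states mutually orthogonal after every outcome can eliminate a state, i.e. have a possible outcome that rules out one of the states. Moreover, every orthogonality-preserving measurement $\{M_m\}$, $\sum_m M_m^\dagger M_m=\mathbb{1}$, by a single party is trivial: each of its effects $M_m^\dagger M_m$ is proportional to the identity. -/

import Mathlib

open Filter Topology Matrix

/-! Two separated parties, holding the spaces `ℂ^A` and `ℂ^B`; the joint space is `ℂ^(A × B)`. -/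

/-- `M ⊗ 1` applied to a joint vector: the first party applies `M`. -/
noncomputable def actFst {A A' B : Type} [Fintype A] (M : Matrix A' A ℂ)
    (v : EuclideanSpace ℂ (A × B)) : EuclideanSpace ℂ (A' × B) :=
  WithLp.toLp 2 fun p => ∑ x, M p.1 x * v (x, p.2)

/-- `1 ⊗ M` applied to a joint vector: the second party applies `M`. -/
noncomputable def actSnd {A B B' : Type} [Fintype B] (M : Matrix B' B ℂ)
    (v : EuclideanSpace ℂ (A × B)) : EuclideanSpace ℂ (A × B') :=
  WithLp.toLp 2 fun p => ∑ y, M p.2 y * v (p.1, y)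

/-- Finite-round LOCC protocols of two parties holding `ℂ^A` and `ℂ^B`, which end with a guess in
`ι`.  In a round, one of the parties applies a quantum instrument to its system, which may change
the dimension of the system (so that ancillas and local memory are included).  Outcome `m` of
the instrument is the completely positive map `ρ ↦ ∑ a, K m a * ρ * (K m a)ᴴ`; it is announced to
both parties, and they continue with a protocol `next m` that may depend on it. -/
inductive LOCC (ι : Type) : Type → Type → Type 1
  | guess {A B : Type} (g : ι) : LOCC ι A B
  | fst {A B : Type} [DecidableEq A] (A' : Type) [Fintype A'] (n r : ℕ)
      (K : Fin n → Fin r → Matrix A' A ℂ) (complete : ∑ m, ∑ a, (K m a)ᴴ * K m a = 1)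
      (next : Fin n → LOCC ι A' B) : LOCC ι A B
  | snd {A B : Type} [DecidableEq B] (B' : Type) [Fintype B'] (n r : ℕ)
      (K : Fin n → Fin r → Matrix B' B ℂ) (complete : ∑ m, ∑ a, (K m a)ᴴ * K m a = 1)
      (next : Fin n → LOCC ι A B') : LOCC ι A B

/-- The probability that the protocol ends with the guess `j` on the input state `v`; for a vector
`v` that is not normalised the probability is multiplied by `‖v‖ ^ 2`. -/
noncomputable def LOCC.prob {ι : Type} [DecidableEq ι] (j : ι) :
    {A B : Type} → [Fintype A] → [Fintype B] → LOCC ι A B → EuclideanSpace ℂ (A × B) → ℝ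
  | _, _, _, _, guess g, v => if g = j then ‖v‖ ^ 2 else 0
  | _, _, _, _, fst _ _ _ K _ next, v => ∑ m, ∑ a, (next m).prob j (actFst (K m a) v)
  | _, _, _, _, snd _ _ _ K _ next, v => ∑ m, ∑ a, (next m).prob j (actSnd (K m a) v)

/-- `Q` carries out `P` and, where `P` stops, possibly performs further rounds (the
provisional guess made by `P` may then be revised). -/
inductive LOCC.Extends {ι : Type} : {A B : Type} → LOCC ι A B → LOCC ι A B → Prop
  | guess {A B : Type} (g : ι) (Q : LOCC ι A B) : Extends (.guess g) Q
  | fst {A B : Type} [DecidableEq A] (A' : Type) [Fintype A'] (n r : ℕ)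
      (K : Fin n → Fin r → Matrix A' A ℂ) (complete : ∑ m, ∑ a, (K m a)ᴴ * K m a = 1)
      (p q : Fin n → LOCC ι A' B) (h : ∀ m, Extends (p m) (q m)) :
      Extends (.fst A' n r K complete p) (.fst A' n r K complete q)
  | snd {A B : Type} [DecidableEq B] (B' : Type) [Fintype B'] (n r : ℕ)
      (K : Fin n → Fin r → Matrix B' B ℂ) (complete : ∑ m, ∑ a, (K m a)ᴴ * K m a = 1)
      (p q : Fin n → LOCC ι A B') (h : ∀ m, Extends (p m) (q m)) :
      Extends (.snd B' n r K complete p) (.snd B' n r K complete q)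

/-- The states `φ j` of two separated parties can be perfectly distinguished by LOCC.  The protocol
may have infinitely many rounds, and is given by its longer and longer finite initial parts, whose
probabilities of identifying each of the states tend to `1`.  A protocol of finitely many rounds
that identifies every state with probability `1` is the special case of a constant sequence. -/
def LOCCDistinguishable {ι A B : Type} [DecidableEq ι] [Fintype A] [Fintype B]
    (φ : ι → EuclideanSpace ℂ (A × B)) : Prop :=
  ∃ P : ℕ → LOCC ι A B, (∀ n, (P n).Extends (P (n + 1))) ∧
    ∀ j, Tendsto (fun n => (P n).prob j (φ j)) atTop (𝓝 1)

/-! Three parties `0, 1, 2`, each holding `ℂ^d`; the space `(ℂ^d)^{⊗3}` is `ℂ^(Fin 3 → Fin d)`. -/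

/-- The space `(ℂ^d)^{⊗3}`. -/
abbrev TripartiteSpace (d : ℕ) : Type := EuclideanSpace ℂ (Fin 3 → Fin d)

/-- The product vector `a ⊗ b ⊗ c`. -/
noncomputable def tripleProduct {d : ℕ} (a b c : EuclideanSpace ℂ (Fin d)) : TripartiteSpace d :=
  WithLp.toLp 2 fun x => a (x 0) * b (x 1) * c (x 2)

/-- A vector of `(ℂ^d)^{⊗3}` seen in the bipartition of party `p` versus the other two parties. -/
noncomputable def cut {d : ℕ} (p : Fin 3) (v : TripartiteSpace d) :
    EuclideanSpace ℂ (Fin d × ({q : Fin 3 // q ≠ p} → Fin d)) :=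
  WithLp.toLp 2 fun y => v ((Equiv.piSplitAt p fun _ => Fin d).symm y)

/-- An orthogonal product basis of `(ℂ^d)^{⊗3}` (made of unit vectors). -/
def IsOrthogonalProductBasis {d : ℕ} {ι : Type} (ψ : ι → TripartiteSpace d) : Prop :=
  (∀ j, ∃ a b c, ψ j = tripleProduct a b c) ∧ Orthonormal ℂ ψ ∧
    Submodule.span ℂ (Set.range ψ) = ⊤

/-- A genuinely nonlocal product basis: across each of the three bipartitions (one party versus the
other two together), the states cannot be perfectly distinguished by LOCC. -/
def IsGenuinelyNonlocalProductBasis {d : ℕ} {ι : Type} [DecidableEq ι]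
    (ψ : ι → TripartiteSpace d) : Prop :=
  IsOrthogonalProductBasis ψ ∧ ∀ p : Fin 3, ¬ LOCCDistinguishable fun j => cut p (ψ j)

/-- A measurement on `ℂ^d` with finitely many outcomes: outcome `m` sends the state vector `v` to
`op m v`, up to normalisation. -/
structure Measurement (d : ℕ) where
  outcomes : ℕ
  dimOut : ℕ
  op : Fin outcomes → Matrix (Fin dimOut) (Fin d) ℂ
  complete : ∑ m, (op m)ᴴ * op m = 1

/-- The measurement effect (POVM element) of the outcome `m`. -/
noncomputable def Measurement.effect {d : ℕ} (M : Measurement d) (m : Fin M.outcomes) :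
    Matrix (Fin d) (Fin d) ℂ :=
  (M.op m)ᴴ * M.op m

/-- All effects are proportional to the identity. -/
def Measurement.IsTrivial {d : ℕ} (M : Measurement d) : Prop :=
  ∀ m, ∃ c : ℂ, M.effect m = c • (1 : Matrix (Fin d) (Fin d) ℂ)

/-- The (unnormalised) state after party `p` alone has measured `M` on `v` and obtained `m`. -/
noncomputable def Measurement.post {d : ℕ} (M : Measurement d) (p : Fin 3) (m : Fin M.outcomes)
    (v : TripartiteSpace d) :
    EuclideanSpace ℂ (Fin M.dimOut × ({q : Fin 3 // q ≠ p} → Fin d)) :=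
  actFst (M.op m) (cut p v)

/-- The measurement `M` of party `p` is orthogonality preserving on the states `ψ j`. -/
def Measurement.IsOrthogonalityPreserving {d : ℕ} {ι : Type} (M : Measurement d) (p : Fin 3)
    (ψ : ι → TripartiteSpace d) : Prop :=
  ∀ m j k, j ≠ k → inner ℂ (M.post p m (ψ j)) (M.post p m (ψ k)) = 0

/-- Some outcome of the measurement `M` of party `p` is possible, but rules out one of the states. -/
def Measurement.Eliminates {d : ℕ} {ι : Type} (M : Measurement d) (p : Fin 3)
    (ψ : ι → TripartiteSpace d) : Prop :=
  ∃ m j k, M.post p m (ψ j) = 0 ∧ M.post p m (ψ k) ≠ 0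

/-- No state can be eliminated by an orthogonality-preserving measurement of one party. -/
def IsLocallyIrreducible {d : ℕ} {ι : Type} (ψ : ι → TripartiteSpace d) : Prop :=
  ∀ (p : Fin 3) (M : Measurement d), M.IsOrthogonalityPreserving p ψ → ¬ M.Eliminates p ψ

/-- A genuinely nonlocal product basis of Type II: it is locally irreducible when all parties are
separated. -/
def IsTypeII {d : ℕ} {ι : Type} [DecidableEq ι] (ψ : ι → TripartiteSpace d) : Prop :=
  IsGenuinelyNonlocalProductBasis ψ ∧ IsLocallyIrreducible ψ

/-! The basis. -/

/-- `|k⟩` -/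
noncomputable def ket (k : Fin 3) : EuclideanSpace ℂ (Fin 3) := EuclideanSpace.single k 1

/-- `|η_s⟩ = (|0⟩ + s |1⟩) / √2` for a sign `s = ±1` -/
noncomputable def ketEta (s : ℤˣ) : EuclideanSpace ℂ (Fin 3) :=
  ((Real.sqrt 2 : ℝ) : ℂ)⁻¹ • (ket 0 + ((s : ℤ) : ℂ) • ket 1)

/-- `|ξ_s⟩ = (|1⟩ + s |2⟩) / √2` for a sign `s = ±1` -/
noncomputable def ketXi (s : ℤˣ) : EuclideanSpace ℂ (Fin 3) :=
  ((Real.sqrt 2 : ℝ) : ℂ)⁻¹ • (ket 1 + ((s : ℤ) : ℂ) • ket 2)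

/-- The 27 states of the basis: six groups of four states, with two independent signs, and the
three states `|k⟩|k⟩|k⟩`. -/
noncomputable def basisII : (Fin 6 × ℤˣ × ℤˣ) ⊕ Fin 3 → TripartiteSpace 3
  | .inl (0, s, t) => tripleProduct (ket 0) (ketEta s) (ketXi t)
  | .inl (1, s, t) => tripleProduct (ketEta s) (ket 2) (ketXi t)
  | .inl (2, s, t) => tripleProduct (ket 2) (ketXi s) (ketEta t)
  | .inl (3, s, t) => tripleProduct (ketEta s) (ketXi t) (ket 0)
  | .inl (4, s, t) => tripleProduct (ketXi s) (ket 0) (ketEta t)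
  | .inl (5, s, t) => tripleProduct (ketXi s) (ketEta t) (ket 2)
  | .inr k => tripleProduct (ket k) (ket k) (ket k)

/-!
The heart of the proof is that the average error of *every* finite LOCC protocol on the states is
bounded below by one positive constant, so that no sequence of protocols can have success
probabilities tending to `1`.

At a node of a protocol, the unnormalised states are `(α ⊗ β) φ j` for a product of Kraus operators;
put `X = αᴴ α` and `Y = βᴴ β`. A measurement by one party splits `X` (or `Y`) into a sum of positive
matrices. Hence a function `F X Y` that is subadditive in each of its two arguments and that is at
most the error wherever the protocol stops is, by induction on the protocol, at most the error at
every node (`LOCC.le_error`). It remains to find such an `F` with `0 < F 1 1`. It is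
(`potential`, up to a constant factor) the homogeneous extension of
`f x y = C * ∑_{j ≠ k} |⟨φ j, (x ⊗ y) φ k⟩|² + max 0 (c - ‖x - 1/dim‖² - ‖y - 1/dim‖²)`,
where `x` and `y` have trace `1`:

* Subadditivity of the extension is convexity of `f` in each variable. The first term is convex, and
  so it suffices that the whole is convex where the maximum is not `0`, that is, for `y` close to a
  multiple of `1`. There, its second derivative in a traceless direction `D` is twice
  `C * ∑_{j ≠ k} |⟨φ j, (D ⊗ y) φ k⟩|² - ‖D‖²`, which is nonnegative for large `C`: by
  compactness and continuity, this follows from the fact that no traceless `D ≠ 0` has all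
  `⟨φ j, (D ⊗ 1) φ k⟩`, `j ≠ k`, equal to `0`.
* Where the protocol stops, two states that overlap cannot both be identified, which bounds the
  first term by the error (Cauchy–Schwarz); and the second term is nonzero only if all states are
  still about equally likely, so that the error is then of order one.

The fact used about `D` is the triviality of orthogonality-preserving measurements, for one
party and for the other two together. If the orthonormal basis consists of products
`φ j = a j ⊗ b j` and all `⟨φ j, (X ⊗ 1) φ k⟩`, `j ≠ k`, are `0`, then each `a j` is an eigenvector
of `X` and of `Xᴴ`, for complex conjugate eigenvalues. So the eigenvalues for `a j` and `a k` agree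
if `⟨a j, a k⟩ ≠ 0`, and `X` is scalar as soon as the graph of these overlaps is connected
(`exists_eq_smul_one_of_actFst`). For the 27 states, the overlaps are determined by
combinatorial labels, and orthogonality and connectedness are decided by evaluation.
-/

open scoped ComplexOrder

/-! ### Local operators and LOCC protocols -/

theorem actFst_add {A A' B : Type} [Fintype A] (M N : Matrix A' A ℂ)
    (v : EuclideanSpace ℂ (A × B)) : actFst (M + N) v = actFst M v + actFst N v := by
  ext p
  simp [actFst, add_mul, Finset.sum_add_distrib]

theorem actFst_smul {A A' B : Type} [Fintype A] (c : ℂ) (M : Matrix A' A ℂ)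
    (v : EuclideanSpace ℂ (A × B)) : actFst (c • M) v = c • actFst M v := by
  ext p
  simp [actFst, Finset.mul_sum, mul_assoc]

theorem actFst_one {A B : Type} [Fintype A] [DecidableEq A] (v : EuclideanSpace ℂ (A × B)) :
    actFst (1 : Matrix A A ℂ) v = v := by
  ext p
  simp [actFst, Matrix.one_apply]

theorem actFst_mul {A A' A'' B : Type} [Fintype A] [Fintype A'] (M : Matrix A'' A' ℂ)
    (N : Matrix A' A ℂ) (v : EuclideanSpace ℂ (A × B)) :
    actFst (M * N) v = actFst M (actFst N v) := by
  ext p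
  simp only [actFst, Matrix.mul_apply, Finset.sum_mul, Finset.mul_sum, mul_assoc]
  exact Finset.sum_comm

theorem actSnd_add {A B B' : Type} [Fintype B] (M N : Matrix B' B ℂ)
    (v : EuclideanSpace ℂ (A × B)) : actSnd (M + N) v = actSnd M v + actSnd N v := by
  ext p
  simp [actSnd, add_mul, Finset.sum_add_distrib]

theorem actSnd_smul {A B B' : Type} [Fintype B] (c : ℂ) (M : Matrix B' B ℂ)
    (v : EuclideanSpace ℂ (A × B)) : actSnd (c • M) v = c • actSnd M v := by
  ext p
  simp [actSnd, Finset.mul_sum, mul_assoc]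

theorem actSnd_one {A B : Type} [Fintype B] [DecidableEq B] (v : EuclideanSpace ℂ (A × B)) :
    actSnd (1 : Matrix B B ℂ) v = v := by
  ext p
  simp [actSnd, Matrix.one_apply]

theorem actSnd_mul {A B B' B'' : Type} [Fintype B] [Fintype B'] (M : Matrix B'' B' ℂ)
    (N : Matrix B' B ℂ) (v : EuclideanSpace ℂ (A × B)) :
    actSnd (M * N) v = actSnd M (actSnd N v) := by
  ext p
  simp only [actSnd, Matrix.mul_apply, Finset.sum_mul, Finset.mul_sum, mul_assoc]
  exact Finset.sum_comm

theorem actFst_vec_add {A A' B : Type} [Fintype A] (M : Matrix A' A ℂ)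
    (v w : EuclideanSpace ℂ (A × B)) : actFst M (v + w) = actFst M v + actFst M w := by
  ext p
  simp [actFst, mul_add, Finset.sum_add_distrib]

theorem actFst_vec_smul {A A' B : Type} [Fintype A] (M : Matrix A' A ℂ) (c : ℂ)
    (v : EuclideanSpace ℂ (A × B)) : actFst M (c • v) = c • actFst M v := by
  ext p
  simp [actFst, Finset.mul_sum, mul_left_comm]

theorem actFst_real_smul_one {A B : Type} [Fintype A] [DecidableEq A] (r : ℝ)
    (v : EuclideanSpace ℂ (A × B)) : actFst (r • (1 : Matrix A A ℂ)) v = (r : ℂ) • v := by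
  rw [← Complex.coe_smul, actFst_smul, actFst_one]

theorem actSnd_real_smul_one {A B : Type} [Fintype B] [DecidableEq B] (r : ℝ)
    (v : EuclideanSpace ℂ (A × B)) : actSnd (r • (1 : Matrix B B ℂ)) v = (r : ℂ) • v := by
  rw [← Complex.coe_smul, actSnd_smul, actSnd_one]

theorem actFst_actSnd {A A' B B' : Type} [Fintype A] [Fintype B] (M : Matrix A' A ℂ)
    (N : Matrix B' B ℂ) (v : EuclideanSpace ℂ (A × B)) :
    actFst M (actSnd N v) = actSnd N (actFst M v) := by
  ext p
  simp only [actFst, actSnd, Finset.mul_sum, mul_left_comm]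
  exact Finset.sum_comm

theorem inner_actFst {A A' B : Type} [Fintype A] [Fintype A'] [Fintype B] (M : Matrix A' A ℂ)
    (u : EuclideanSpace ℂ (A × B)) (v : EuclideanSpace ℂ (A' × B)) :
    inner ℂ (actFst M u) v = inner ℂ u (actFst Mᴴ v) := by
  simp only [actFst, PiLp.inner_apply, Fintype.sum_prod_type_right, RCLike.inner_apply, map_sum,
    map_mul, Finset.mul_sum, Finset.sum_mul, Matrix.conjTranspose_apply]
  refine Finset.sum_congr rfl fun y _ => ?_
  rw [Finset.sum_comm]
  refine Finset.sum_congr rfl fun x _ => Finset.sum_congr rfl fun x' _ => ?_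
  simp only [starRingEnd_apply]
  ring

theorem inner_actSnd {A B B' : Type} [Fintype A] [Fintype B] [Fintype B'] (M : Matrix B' B ℂ)
    (u : EuclideanSpace ℂ (A × B)) (v : EuclideanSpace ℂ (A × B')) :
    inner ℂ (actSnd M u) v = inner ℂ u (actSnd Mᴴ v) := by
  simp only [actSnd, PiLp.inner_apply, Fintype.sum_prod_type, RCLike.inner_apply, map_sum,
    map_mul, Finset.mul_sum, Finset.sum_mul, Matrix.conjTranspose_apply]
  refine Finset.sum_congr rfl fun y _ => ?_
  rw [Finset.sum_comm]
  refine Finset.sum_congr rfl fun x _ => Finset.sum_congr rfl fun x' _ => ?_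
  simp only [starRingEnd_apply]
  ring

theorem norm_sq_actFst {A A' B : Type} [Fintype A] [Fintype A'] [Fintype B] (M : Matrix A' A ℂ)
    (v : EuclideanSpace ℂ (A × B)) :
    ‖actFst M v‖ ^ 2 = (inner ℂ v (actFst (Mᴴ * M) v)).re := by
  rw [actFst_mul, ← inner_actFst, ← inner_self_eq_norm_sq (𝕜 := ℂ)]
  rfl

theorem norm_sq_actSnd {A B B' : Type} [Fintype A] [Fintype B] [Fintype B'] (M : Matrix B' B ℂ)
    (v : EuclideanSpace ℂ (A × B)) :
    ‖actSnd M v‖ ^ 2 = (inner ℂ v (actSnd (Mᴴ * M) v)).re := by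
  rw [actSnd_mul, ← inner_actSnd, ← inner_self_eq_norm_sq (𝕜 := ℂ)]
  rfl

theorem actFst_sum {κ A A' B : Type} [Fintype A] (s : Finset κ) (M : κ → Matrix A' A ℂ)
    (v : EuclideanSpace ℂ (A × B)) : actFst (∑ i ∈ s, M i) v = ∑ i ∈ s, actFst (M i) v := by
  classical
  induction s using Finset.induction_on with
  | empty => ext p; simp [actFst]
  | insert i s hi ih => rw [Finset.sum_insert hi, Finset.sum_insert hi, actFst_add, ih]

theorem actSnd_sum {κ A B B' : Type} [Fintype B] (s : Finset κ) (M : κ → Matrix B' B ℂ)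
    (v : EuclideanSpace ℂ (A × B)) : actSnd (∑ i ∈ s, M i) v = ∑ i ∈ s, actSnd (M i) v := by
  classical
  induction s using Finset.induction_on with
  | empty => ext p; simp [actSnd]
  | insert i s hi ih => rw [Finset.sum_insert hi, Finset.sum_insert hi, actSnd_add, ih]

theorem sum_norm_sq_actFst {κ A A' B : Type} [Fintype κ] [Fintype A] [DecidableEq A] [Fintype A']
    [Fintype B] (K : κ → Matrix A' A ℂ) (hK : ∑ i, (K i)ᴴ * K i = 1)
    (v : EuclideanSpace ℂ (A × B)) : ∑ i, ‖actFst (K i) v‖ ^ 2 = ‖v‖ ^ 2 := by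
  simp only [norm_sq_actFst, ← Complex.re_sum, ← inner_sum, ← actFst_sum, hK, actFst_one]
  exact inner_self_eq_norm_sq (𝕜 := ℂ) v

theorem sum_norm_sq_actSnd {κ A B B' : Type} [Fintype κ] [Fintype A] [Fintype B] [DecidableEq B]
    [Fintype B'] (K : κ → Matrix B' B ℂ) (hK : ∑ i, (K i)ᴴ * K i = 1)
    (v : EuclideanSpace ℂ (A × B)) : ∑ i, ‖actSnd (K i) v‖ ^ 2 = ‖v‖ ^ 2 := by
  simp only [norm_sq_actSnd, ← Complex.re_sum, ← inner_sum, ← actSnd_sum, hK, actSnd_one]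
  exact inner_self_eq_norm_sq (𝕜 := ℂ) v

theorem sum_conjTranspose_mul_self_mul {κ A A' A₀ : Type} [Fintype κ] [Fintype A] [DecidableEq A]
    [Fintype A'] [Fintype A₀] (K : κ → Matrix A' A ℂ) (hK : ∑ i, (K i)ᴴ * K i = 1)
    (α : Matrix A A₀ ℂ) : ∑ i, (K i * α)ᴴ * (K i * α) = αᴴ * α := by
  have h : ∀ i, (K i * α)ᴴ * (K i * α) = αᴴ * ((K i)ᴴ * K i) * α := fun i => by
    simp only [Matrix.conjTranspose_mul, Matrix.mul_assoc]
  simp only [h]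
  rw [← Matrix.sum_mul, ← Matrix.mul_sum, hK, Matrix.mul_one]

/-- A function of the two local Gram matrices `αᴴ α` and `βᴴ β` that is subadditive in each of them,
and that bounds the error from below if the protocol stops at once, bounds the error of every
protocol from below. The error on the state `v` is `‖v‖ ^ 2` minus the probability of the right
guess, because the total probability of all guesses is `‖v‖ ^ 2`. -/
theorem LOCC.le_error {ι A₀ B₀ : Type} [Fintype ι] [DecidableEq ι] [Fintype A₀] [Fintype B₀]
    (φ : ι → EuclideanSpace ℂ (A₀ × B₀))
    (F : Matrix A₀ A₀ ℂ → Matrix B₀ B₀ ℂ → ℝ)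
    (hguess : ∀ {A B : Type} [Fintype A] [Fintype B] (α : Matrix A A₀ ℂ) (β : Matrix B B₀ ℂ)
      (g : ι), F (αᴴ * α) (βᴴ * β) ≤
        ∑ j ∈ Finset.univ.erase g, ‖actFst α (actSnd β (φ j))‖ ^ 2)
    (hfst : ∀ (κ : Type) [Fintype κ] (X : κ → Matrix A₀ A₀ ℂ) (Y : Matrix B₀ B₀ ℂ),
      (∀ i, (X i).PosSemidef) → Y.PosSemidef → F (∑ i, X i) Y ≤ ∑ i, F (X i) Y)
    (hsnd : ∀ (κ : Type) [Fintype κ] (X : Matrix A₀ A₀ ℂ) (Y : κ → Matrix B₀ B₀ ℂ),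
      X.PosSemidef → (∀ i, (Y i).PosSemidef) → F X (∑ i, Y i) ≤ ∑ i, F X (Y i))
    {A B : Type} (P : LOCC ι A B) : ∀ [Fintype A] [Fintype B] (α : Matrix A A₀ ℂ)
    (β : Matrix B B₀ ℂ),
    F (αᴴ * α) (βᴴ * β) ≤ ∑ j, (‖actFst α (actSnd β (φ j))‖ ^ 2
      - P.prob j (actFst α (actSnd β (φ j)))) := by
  induction P with
  | guess g =>
    intro _ _ α β
    refine (hguess α β g).trans (le_of_eq ?_)
    rw [← Finset.add_sum_erase _ _ (Finset.mem_univ g)]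
    simp only [LOCC.prob, if_true, sub_self, zero_add]
    refine Finset.sum_congr rfl fun j hj => ?_
    rw [if_neg (Finset.ne_of_mem_erase hj).symm, sub_zero]
  | @fst A B _ A' _ n r K hK next ih =>
    intro _ _ α β
    have hK' : ∑ i : Fin n × Fin r, (K i.1 i.2)ᴴ * K i.1 i.2 = 1 := by
      rw [Fintype.sum_prod_type]
      convert hK
    have key : ∀ i : Fin n × Fin r, F ((K i.1 i.2 * α)ᴴ * (K i.1 i.2 * α)) (βᴴ * β) ≤
        ∑ j, (‖actFst (K i.1 i.2) (actFst α (actSnd β (φ j)))‖ ^ 2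
          - (next i.1).prob j (actFst (K i.1 i.2) (actFst α (actSnd β (φ j))))) := fun i => by
      simpa only [actFst_mul] using ih i.1 (K i.1 i.2 * α) β
    rw [← sum_conjTranspose_mul_self_mul (fun i : Fin n × Fin r => K i.1 i.2) hK' α]
    refine (hfst _ _ _ (fun i => posSemidef_conjTranspose_mul_self _)
      (posSemidef_conjTranspose_mul_self β)).trans
      ((Finset.sum_le_sum fun i _ => key i).trans (le_of_eq ?_))
    rw [Finset.sum_comm]
    refine Finset.sum_congr rfl fun j _ => ?_
    rw [Finset.sum_sub_distrib, sum_norm_sq_actFst (fun i : Fin n × Fin r => K i.1 i.2) hK',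
      LOCC.prob, Fintype.sum_prod_type]
  | @snd A B _ B' _ n r K hK next ih =>
    intro _ _ α β
    have hK' : ∑ i : Fin n × Fin r, (K i.1 i.2)ᴴ * K i.1 i.2 = 1 := by
      rw [Fintype.sum_prod_type]
      convert hK
    have key : ∀ i : Fin n × Fin r, F (αᴴ * α) ((K i.1 i.2 * β)ᴴ * (K i.1 i.2 * β)) ≤
        ∑ j, (‖actSnd (K i.1 i.2) (actFst α (actSnd β (φ j)))‖ ^ 2
          - (next i.1).prob j (actSnd (K i.1 i.2) (actFst α (actSnd β (φ j))))) := fun i => by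
      simpa only [actSnd_mul, actFst_actSnd] using ih i.1 α (K i.1 i.2 * β)
    rw [← sum_conjTranspose_mul_self_mul (fun i : Fin n × Fin r => K i.1 i.2) hK' β]
    refine (hsnd _ _ _ (posSemidef_conjTranspose_mul_self α)
      (fun i => posSemidef_conjTranspose_mul_self _)).trans
      ((Finset.sum_le_sum fun i _ => key i).trans (le_of_eq ?_))
    rw [Finset.sum_comm]
    refine Finset.sum_congr rfl fun j _ => ?_
    rw [Finset.sum_sub_distrib, sum_norm_sq_actSnd (fun i : Fin n × Fin r => K i.1 i.2) hK',
      LOCC.prob, Fintype.sum_prod_type]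

/-! ### The Frobenius norm -/

/-- The square of the Frobenius norm, kept free of a choice of norm instance on matrices. -/
noncomputable def frobSq {m n : Type} [Fintype m] [Fintype n] (M : Matrix m n ℂ) : ℝ :=
  ∑ i, ∑ j, ‖M i j‖ ^ 2

section frobSq
variable {m n : Type} [Fintype m] [Fintype n]

theorem frobSq_nonneg (M : Matrix m n ℂ) : 0 ≤ frobSq M :=
  Finset.sum_nonneg fun _ _ => Finset.sum_nonneg fun _ _ => sq_nonneg _

theorem frobSq_smul (r : ℝ) (M : Matrix m n ℂ) : frobSq (r • M) = r ^ 2 * frobSq M := by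
  simp [frobSq, Finset.mul_sum, mul_pow]

/-- The exact defect in the convexity of the squared norm. -/
theorem frobSq_convex_combination {a b : ℝ} (hab : a + b = 1) (M N : Matrix m n ℂ) :
    frobSq (a • M + b • N) = a * frobSq M + b * frobSq N - a * b * frobSq (M - N) := by
  simp only [frobSq, Finset.mul_sum, ← Finset.sum_add_distrib, ← Finset.sum_sub_distrib]
  refine Finset.sum_congr rfl fun i _ => Finset.sum_congr rfl fun j _ => ?_
  obtain rfl : b = 1 - a := by linarith
  simp only [Complex.sq_norm, Complex.normSq_apply, Matrix.add_apply, Matrix.smul_apply,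
    Matrix.sub_apply, Complex.add_re, Complex.add_im, Complex.sub_re, Complex.sub_im,
    Complex.real_smul, Complex.mul_re, Complex.mul_im, Complex.ofReal_re, Complex.ofReal_im]
  ring

theorem norm_sq_le_frobSq (M : Matrix m n ℂ) (i : m) (j : n) : ‖M i j‖ ^ 2 ≤ frobSq M :=
  (Finset.single_le_sum (f := fun j => ‖M i j‖ ^ 2) (fun _ _ => sq_nonneg _)
    (Finset.mem_univ j)).trans
  (Finset.single_le_sum (f := fun i => ∑ j, ‖M i j‖ ^ 2)
    (fun _ _ => Finset.sum_nonneg fun _ _ => sq_nonneg _) (Finset.mem_univ i))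

theorem frobSq_eq_zero {M : Matrix m n ℂ} : frobSq M = 0 ↔ M = 0 := by
  refine ⟨fun h => ?_, fun h => by simp [h, frobSq]⟩
  ext i j
  have := norm_sq_le_frobSq M i j
  rw [h] at this
  simpa using le_antisymm this (sq_nonneg _)

theorem continuous_frobSq : Continuous (frobSq : Matrix m n ℂ → ℝ) := by
  unfold frobSq
  fun_prop

theorem trace_conjTranspose_mul_self (M : Matrix m n ℂ) :
    (Mᴴ * M).trace = (frobSq M : ℂ) := by
  simp only [frobSq, Matrix.trace, Matrix.diag, Matrix.mul_apply, Matrix.conjTranspose_apply]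
  rw [Finset.sum_comm]
  push_cast
  refine Finset.sum_congr rfl fun i _ => Finset.sum_congr rfl fun j _ => ?_
  rw [← Complex.conj_mul']
  rfl

/-- The sets `frobSq (M - M₀) < c` form a basis of neighbourhoods of `M₀`. -/
theorem exists_frobSq_lt_imp {P : Matrix m n ℂ → Prop} {M₀ : Matrix m n ℂ}
    (h : ∀ᶠ M in 𝓝 M₀, P M) : ∃ c > 0, ∀ M, frobSq (M - M₀) < c → P M := by
  obtain ⟨ε, hε, H⟩ := (Metric.eventually_nhds_iff (α := m → n → ℂ)).1 h
  refine ⟨ε ^ 2, by positivity, fun M hM => H ?_⟩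
  refine (dist_pi_lt_iff hε).2 fun i => (dist_pi_lt_iff hε).2 fun j => ?_
  rw [dist_eq_norm]
  exact lt_of_pow_lt_pow_left₀ 2 hε.le ((norm_sq_le_frobSq (M - M₀) i j).trans_lt hM)

end frobSq

theorem norm_sq_actFst_le {A A' B : Type} [Fintype A] [Fintype A'] [Fintype B]
    (M : Matrix A' A ℂ) (v : EuclideanSpace ℂ (A × B)) :
    ‖actFst M v‖ ^ 2 ≤ frobSq M * ‖v‖ ^ 2 := by
  simp only [EuclideanSpace.norm_sq_eq, actFst, Fintype.sum_prod_type_right]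
  rw [Finset.mul_sum]
  refine Finset.sum_le_sum fun y _ => ?_
  rw [frobSq, Finset.sum_mul]
  refine Finset.sum_le_sum fun a _ => ?_
  refine (pow_le_pow_left₀ (norm_nonneg _) (norm_sum_le _ _) 2).trans ?_
  simp only [norm_mul]
  exact Finset.sum_mul_sq_le_sq_mul_sq _ _ _

theorem norm_sq_actSnd_le {A B B' : Type} [Fintype A] [Fintype B] [Fintype B']
    (M : Matrix B' B ℂ) (v : EuclideanSpace ℂ (A × B)) :
    ‖actSnd M v‖ ^ 2 ≤ frobSq M * ‖v‖ ^ 2 := by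
  simp only [EuclideanSpace.norm_sq_eq, actSnd, Fintype.sum_prod_type]
  rw [Finset.mul_sum]
  refine Finset.sum_le_sum fun y _ => ?_
  rw [frobSq, Finset.sum_mul]
  refine Finset.sum_le_sum fun a _ => ?_
  refine (pow_le_pow_left₀ (norm_nonneg _) (norm_sum_le _ _) 2).trans ?_
  simp only [norm_mul]
  exact Finset.sum_mul_sq_le_sq_mul_sq _ _ _

/-- The perspective `X ↦ τ X * f (X / τ X)` of a convex function is subadditive. The hypothesis `hX`
takes care of the junk value of the division where `τ` vanishes. -/
theorem ConvexOn.perspective_sum_le {V κ : Type} [AddCommGroup V] [Module ℝ V] [Fintype κ]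
    {S : Set V} {f : V → ℝ} (hf : ConvexOn ℝ S f) (τ : V →ₗ[ℝ] ℝ) (X : κ → V)
    (hτ : ∀ i, 0 ≤ τ (X i)) (hX : ∀ i, τ (X i) = 0 → X i = 0)
    (hS : ∀ i, τ (X i) ≠ 0 → (τ (X i))⁻¹ • X i ∈ S) :
    τ (∑ i, X i) * f ((τ (∑ i, X i))⁻¹ • ∑ i, X i) ≤
      ∑ i, τ (X i) * f ((τ (X i))⁻¹ • X i) := by
  classical
  set T := τ (∑ i, X i) with hT
  have hTsum : T = ∑ i, τ (X i) := by rw [hT, map_sum]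
  have hT0 : 0 ≤ T := hTsum ▸ Finset.sum_nonneg fun i _ => hτ i
  rcases hT0.eq_or_lt with h0 | hpos
  · have hi : ∀ i, τ (X i) = 0 := fun i =>
      (Finset.sum_eq_zero_iff_of_nonneg fun i _ => hτ i).1 (hTsum.symm.trans h0.symm) i
        (Finset.mem_univ i)
    simp [← h0, hi]
  · have hfil : ∀ g : κ → ℝ, ∑ i with τ (X i) ≠ 0, τ (X i) * g i = ∑ i, τ (X i) * g i :=
      fun g => Finset.sum_filter_of_ne fun i _ h => left_ne_zero_of_mul h
    have hJ := hf.map_sum_le (t := Finset.univ.filter fun i => τ (X i) ≠ 0)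
      (w := fun i => τ (X i) * T⁻¹) (p := fun i => (τ (X i))⁻¹ • X i)
      (fun i _ => mul_nonneg (hτ i) (inv_nonneg.2 hT0))
      (by rw [hfil fun _ => T⁻¹, ← Finset.sum_mul, ← hTsum, mul_inv_cancel₀ hpos.ne'])
      (fun i hi => hS i (Finset.mem_filter.1 hi).2)
    have hpt : ∑ i with τ (X i) ≠ 0, (τ (X i) * T⁻¹) • (τ (X i))⁻¹ • X i =
        T⁻¹ • ∑ i, X i := by
      rw [Finset.smul_sum, Finset.sum_filter]
      refine Finset.sum_congr rfl fun i _ => ?_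
      split_ifs with h
      · rw [smul_smul, mul_right_comm, mul_inv_cancel₀ h, one_mul]
      · rw [hX i (not_not.1 h), smul_zero]
    rw [hpt] at hJ
    simp only [smul_eq_mul, mul_assoc, hfil fun i => T⁻¹ * f ((τ (X i))⁻¹ • X i)] at hJ
    calc T * f (T⁻¹ • ∑ i, X i)
        ≤ T * ∑ i, τ (X i) * (T⁻¹ * f ((τ (X i))⁻¹ • X i)) := by gcongr
      _ = ∑ i, τ (X i) * f ((τ (X i))⁻¹ • X i) := by
        rw [Finset.mul_sum]
        refine Finset.sum_congr rfl fun i _ => ?_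
        field_simp

section potential
variable {A B ι : Type} [Fintype A] [Fintype ι]

/-- A difference of two squared seminorms is convex on the matrices of trace `1` if it is
nonnegative on differences of such matrices. -/
theorem convexOn_frobSq_sub {L : Matrix A A ℂ →ₗ[ℂ] Matrix ι ι ℂ} {C e : ℝ}
    (h : ∀ D, D.trace = 0 → e * frobSq D ≤ C * frobSq (L D)) (x₀ : Matrix A A ℂ) (d : ℝ) :
    ConvexOn ℝ {x : Matrix A A ℂ | x.trace = 1}
      fun x => C * frobSq (L x) - e * frobSq (x - x₀) + d := by
  refine ⟨fun x hx y hy a b _ _ hab => ?_, fun x hx y hy a b ha hb hab => ?_⟩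
  · have : (a : ℂ) + b = 1 := by exact_mod_cast hab
    simp_all
  · have hD := h (x - y) (by simp_all)
    have h1 : a • x + b • y - x₀ = a • (x - x₀) + b • (y - x₀) := by
      obtain rfl : b = 1 - a := by linarith
      module
    have h2 : L (a • x + b • y) = a • L x + b • L y := by
      rw [map_add, LinearMap.map_smul_of_tower, LinearMap.map_smul_of_tower]
    simp only [h1, h2, frobSq_convex_combination hab, smul_eq_mul, sub_sub_sub_cancel_right]
    rw [← map_sub]
    have := mul_le_mul_of_nonneg_left hD (mul_nonneg ha hb)
    obtain rfl : b = 1 - a := by linarith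
    nlinarith

/-- The potential is convex in one variable; `d` stands for the squared distance of the other
variable from the maximally mixed matrix, and a lower bound for `L` is needed only if that is less
than `c`. -/
theorem convexOn_frobSq_add_max {L : Matrix A A ℂ →ₗ[ℂ] Matrix ι ι ℂ} {C c d : ℝ} (hC : 0 ≤ C)
    (h : d < c → ∀ D, D.trace = 0 → frobSq D ≤ C * frobSq (L D)) (x₀ : Matrix A A ℂ) :
    ConvexOn ℝ {x : Matrix A A ℂ | x.trace = 1}
      fun x => C * frobSq (L x) + max 0 (c - frobSq (x - x₀) - d) := by
  have h0 := convexOn_frobSq_sub (L := L) (C := C) (e := 0)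
    (fun D _ => by simpa using mul_nonneg hC (frobSq_nonneg _)) x₀ 0
  rcases lt_or_ge d c with hd | hd
  · have h1 := convexOn_frobSq_sub (L := L) (C := C) (e := 1) (by simpa using h hd) x₀ (c - d)
    refine (h0.sup h1).congr fun x _ => ?_
    rw [Pi.sup_apply, ← max_add_add_left]
    congr 1 <;> ring
  · convert h0 using 2 with x
    rw [max_eq_left (by linarith [frobSq_nonneg (x - x₀)])]
    ring

/-- If `D ↦ L D y₀` is injective on traceless matrices, then it is bounded below there,
uniformly for `y` near `y₀`. -/
theorem exists_eventually_le_frobSq (L : Matrix A A ℂ →ₗ[ℂ] Matrix B B ℂ →ₗ[ℂ] Matrix ι ι ℂ)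
    (hL : Continuous fun p : Matrix A A ℂ × Matrix B B ℂ => L p.1 p.2) (y₀ : Matrix B B ℂ)
    (h : ∀ D, D.trace = 0 → L D y₀ = 0 → D = 0) :
    ∃ κ > 0, ∀ᶠ y in 𝓝 y₀, ∀ D, D.trace = 0 → κ * frobSq D ≤ frobSq (L D y) := by
  set K : Set (Matrix A A ℂ) := {D | D.trace = 0 ∧ frobSq D = 1} with hK
  have hKc : IsCompact K := by
    refine IsCompact.of_isClosed_subset (isCompact_univ_pi fun _ : A => isCompact_univ_pi
      fun _ : A => isCompact_closedBall (0 : ℂ) 1) ?_ ?_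
    · exact (isClosed_eq (by fun_prop) continuous_const).inter
        (isClosed_eq continuous_frobSq continuous_const)
    · intro D hD
      refine Set.mem_univ_pi.2 fun i => Set.mem_univ_pi.2 fun j => ?_
      rw [mem_closedBall_zero_iff]
      exact (sq_le_one_iff₀ (norm_nonneg _)).1 (hD.2 ▸ norm_sq_le_frobSq D i j)
  have hcont : Continuous fun p : Matrix B B ℂ × Matrix A A ℂ => frobSq (L p.2 p.1) :=
    continuous_frobSq.comp (hL.comp continuous_swap)
  obtain ⟨κ, hκ, hmin⟩ : ∃ κ > 0, ∀ D ∈ K, κ < frobSq (L D y₀) := by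
    rcases K.eq_empty_or_nonempty with hE | hne
    · exact ⟨1, one_pos, by simp [hE]⟩
    · obtain ⟨D₀, hD₀, hm⟩ := hKc.exists_isMinOn hne
        (hcont.comp (Continuous.prodMk_right y₀)).continuousOn
      have hp : 0 < frobSq (L D₀ y₀) := by
        refine (frobSq_nonneg _).lt_of_ne fun h0 => ?_
        have := h D₀ hD₀.1 (frobSq_eq_zero.1 h0.symm)
        have h1 := hD₀.2
        rw [this, frobSq_eq_zero.2 rfl] at h1
        exact zero_ne_one h1
      exact ⟨_, half_pos hp, fun D hD => (half_lt_self hp).trans_le (hm hD)⟩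
  refine ⟨κ, hκ, (hKc.eventually_forall_of_forall_eventually
    (P := fun y D => κ < frobSq (L D y)) fun D hD =>
      hcont.continuousAt.eventually (lt_mem_nhds (hmin D hD))).mono fun y hy D hD => ?_⟩
  rcases (frobSq_nonneg D).eq_or_lt with h0 | hpos
  · rw [← h0, mul_zero]
    exact frobSq_nonneg _
  · have hs : (√(frobSq D))⁻¹ ^ 2 = (frobSq D)⁻¹ := by rw [inv_pow, Real.sq_sqrt hpos.le]
    have := hy ((√(frobSq D))⁻¹ • D)
      ⟨by rw [Matrix.trace_smul, hD, smul_zero],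
        by rw [frobSq_smul, hs, inv_mul_cancel₀ hpos.ne']⟩
    rw [LinearMap.map_smul_of_tower, LinearMap.smul_apply, frobSq_smul, hs, inv_mul_eq_div,
      lt_div_iff₀ hpos] at this
    exact this.le

end potential

/-! ### Off-diagonal entries of product operators -/

section offDiag
variable {A B ι : Type} [Fintype A] [Fintype B] [DecidableEq ι]

/-- The matrix of `X ⊗ Y` with respect to the vectors `φ j`, with the diagonal entries replaced by
`0`, as a bilinear map in `X` and `Y`. -/
noncomputable def offDiag (φ : ι → EuclideanSpace ℂ (A × B)) :
    Matrix A A ℂ →ₗ[ℂ] Matrix B B ℂ →ₗ[ℂ] Matrix ι ι ℂ :=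
  LinearMap.mk₂ ℂ
    (fun X Y => Matrix.of fun j k =>
      if j = k then 0 else inner ℂ (φ j) (actFst X (actSnd Y (φ k))))
    (fun X X' Y => by
      ext j k
      by_cases h : j = k <;> simp [h, actFst_add])
    (fun c X Y => by
      ext j k
      by_cases h : j = k <;> simp [h, actFst_smul])
    (fun X Y Y' => by
      ext j k
      by_cases h : j = k <;> simp [h, actSnd_add, actFst_vec_add])
    (fun c X Y => by
      ext j k
      by_cases h : j = k <;> simp [h, actSnd_smul, actFst_vec_smul])

theorem offDiag_apply (φ : ι → EuclideanSpace ℂ (A × B)) (X : Matrix A A ℂ) (Y : Matrix B B ℂ)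
    (j k : ι) : offDiag φ X Y j k =
      if j = k then 0 else inner ℂ (φ j) (actFst X (actSnd Y (φ k))) := rfl

theorem continuous_inner_actFst_actSnd (u v : EuclideanSpace ℂ (A × B)) :
    Continuous fun p : Matrix A A ℂ × Matrix B B ℂ =>
      inner ℂ u (actFst p.1 (actSnd p.2 v)) := by
  simp only [PiLp.inner_apply, actFst, actSnd, RCLike.inner_apply]
  fun_prop

theorem continuous_offDiag (φ : ι → EuclideanSpace ℂ (A × B)) :
    Continuous fun p : Matrix A A ℂ × Matrix B B ℂ => offDiag φ p.1 p.2 := by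
  refine continuous_matrix fun j k => ?_
  simp only [offDiag_apply]
  split_ifs
  · exact continuous_const
  · exact continuous_inner_actFst_actSnd _ _

theorem inner_actFst_actSnd_gram {A' B' : Type} [Fintype A'] [Fintype B'] (α : Matrix A' A ℂ)
    (β : Matrix B' B ℂ) (u v : EuclideanSpace ℂ (A × B)) :
    inner ℂ u (actFst (αᴴ * α) (actSnd (βᴴ * β) v)) =
      inner ℂ (actFst α (actSnd β u)) (actFst α (actSnd β v)) := by
  rw [inner_actFst, inner_actSnd, ← actFst_mul, ← actFst_actSnd, ← actSnd_mul]

theorem eventually_half_lt_inner {A B ι : Type} [Fintype A] [Fintype B] [Fintype ι]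
    [DecidableEq A] [DecidableEq B] {φ : ι → EuclideanSpace ℂ (A × B)} (hφ : ∀ j, ‖φ j‖ = 1)
    {r s : ℝ} (hr : 0 < r) (hs : 0 < s) :
    ∀ᶠ p in 𝓝 (r • (1 : Matrix A A ℂ), s • (1 : Matrix B B ℂ)), ∀ j,
      r * s / 2 < (inner ℂ (φ j) (actFst p.1 (actSnd p.2 (φ j)))).re := by
  refine eventually_all.2 fun j => (Complex.continuous_re.comp
    (continuous_inner_actFst_actSnd (φ j) (φ j))).continuousAt.eventually (lt_mem_nhds ?_)
  have : inner ℂ (φ j) (actFst (r • (1 : Matrix A A ℂ)) (actSnd (s • (1 : Matrix B B ℂ)) (φ j))) =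
      ((r * s : ℝ) : ℂ) := by
    rw [actFst_real_smul_one, actSnd_real_smul_one, inner_smul_right,
      inner_smul_right, inner_self_eq_norm_sq_to_K, hφ j]
    simp
  simp only [Function.comp_apply, this, Complex.ofReal_re]
  exact half_lt_self (by positivity)

end offDiag

theorem eq_zero_of_trace_of_scalar {A : Type} [Fintype A] [DecidableEq A] [Nonempty A]
    {D : Matrix A A ℂ} (h : ∃ c : ℂ, D = c • (1 : Matrix A A ℂ)) (hD : D.trace = 0) : D = 0 := by
  obtain ⟨c, rfl⟩ := h
  have : c = 0 := by simpa using hD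
  rw [this, zero_smul]

theorem Matrix.PosSemidef.trace_eq_re {A : Type} [Fintype A] {X : Matrix A A ℂ}
    (hX : X.PosSemidef) : X.trace = (X.trace.re : ℂ) :=
  Complex.ext rfl (Complex.nonneg_iff.1 hX.trace_nonneg).2.symm

/-- The real part of the trace, as a real-linear functional. -/
noncomputable def reTrace (A : Type) [Fintype A] : Matrix A A ℂ →ₗ[ℝ] ℝ :=
  Complex.reLm ∘ₗ Matrix.traceLinearMap A ℝ ℂ

theorem reTrace_apply {A : Type} [Fintype A] (X : Matrix A A ℂ) :
    reTrace A X = X.trace.re := rfl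

theorem Matrix.PosSemidef.perspective_sum_le {A κ : Type} [Fintype A] [Fintype κ]
    {f : Matrix A A ℂ → ℝ} (hf : ConvexOn ℝ {x : Matrix A A ℂ | x.trace = 1} f)
    {X : κ → Matrix A A ℂ} (hX : ∀ i, (X i).PosSemidef) :
    reTrace A (∑ i, X i) * f ((reTrace A (∑ i, X i))⁻¹ • ∑ i, X i) ≤
      ∑ i, reTrace A (X i) * f ((reTrace A (X i))⁻¹ • X i) := by
  refine hf.perspective_sum_le _ X
    (fun i => (Complex.nonneg_iff.1 (hX i).trace_nonneg).1) (fun i h => ?_) fun i h => ?_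
  · refine (hX i).trace_eq_zero_iff.1 ?_
    rw [(hX i).trace_eq_re]
    exact_mod_cast h
  · have h' : ((X i).trace.re : ℂ) ≠ 0 := by exact_mod_cast h
    rw [Set.mem_ofPred_eq, Matrix.trace_smul, reTrace_apply, Complex.real_smul,
      Complex.ofReal_inv]
    nth_rw 2 [(hX i).trace_eq_re]
    exact inv_mul_cancel₀ h'

/-! ### The potential and the error bound -/

section bound
variable {A B ι : Type} [Fintype A] [Fintype B] [Fintype ι] [DecidableEq ι]
  [DecidableEq A] [DecidableEq B]

/-- The potential on matrices `x` and `y` of trace `1`. The first term measures how far `x ⊗ y` is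
from keeping the states orthogonal, the second one how close `x` and `y` are to the maximally mixed
matrices. -/
noncomputable def normalizedPotential (φ : ι → EuclideanSpace ℂ (A × B)) (C c : ℝ)
    (x : Matrix A A ℂ) (y : Matrix B B ℂ) : ℝ :=
  C * frobSq (offDiag φ x y) +
    max 0 (c - frobSq (x - (Fintype.card A : ℝ)⁻¹ • (1 : Matrix A A ℂ))
      - frobSq (y - (Fintype.card B : ℝ)⁻¹ • (1 : Matrix B B ℂ)))

/-- The extension of `normalizedPotential` to all pairs of positive semidefinite matrices that is
homogeneous in both variables. If a trace is `0`, the value is `0`. -/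
noncomputable def potential (φ : ι → EuclideanSpace ℂ (A × B)) (C c : ℝ)
    (X : Matrix A A ℂ) (Y : Matrix B B ℂ) : ℝ :=
  reTrace A X * (reTrace B Y *
    normalizedPotential φ C c ((reTrace A X)⁻¹ • X) ((reTrace B Y)⁻¹ • Y))

theorem potential_sum_left_le {φ : ι → EuclideanSpace ℂ (A × B)} {C c : ℝ} (hC : 0 ≤ C)
    (h : ∀ y : Matrix B B ℂ, frobSq (y - (Fintype.card B : ℝ)⁻¹ • (1 : Matrix B B ℂ)) < c →
      ∀ D, D.trace = 0 → frobSq D ≤ C * frobSq (offDiag φ D y))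
    {κ : Type} [Fintype κ] {X : κ → Matrix A A ℂ} {Y : Matrix B B ℂ}
    (hX : ∀ i, (X i).PosSemidef) (hY : Y.PosSemidef) :
    potential φ C c (∑ i, X i) Y ≤ ∑ i, potential φ C c (X i) Y := by
  have hf := convexOn_frobSq_add_max (L := (offDiag φ).flip ((reTrace B Y)⁻¹ • Y)) hC (h _)
    ((Fintype.card A : ℝ)⁻¹ • (1 : Matrix A A ℂ))
  have := mul_le_mul_of_nonneg_left (Matrix.PosSemidef.perspective_sum_le hf hX)
    (Complex.nonneg_iff.1 hY.trace_nonneg).1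
  simp only [Finset.mul_sum, mul_left_comm Y.trace.re] at this
  exact this

theorem potential_sum_right_le {φ : ι → EuclideanSpace ℂ (A × B)} {C c : ℝ} (hC : 0 ≤ C)
    (h : ∀ x : Matrix A A ℂ, frobSq (x - (Fintype.card A : ℝ)⁻¹ • (1 : Matrix A A ℂ)) < c →
      ∀ D, D.trace = 0 → frobSq D ≤ C * frobSq (offDiag φ x D))
    {κ : Type} [Fintype κ] {X : Matrix A A ℂ} {Y : κ → Matrix B B ℂ}
    (hX : X.PosSemidef) (hY : ∀ i, (Y i).PosSemidef) :
    potential φ C c X (∑ i, Y i) ≤ ∑ i, potential φ C c X (Y i) := by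
  have hf := convexOn_frobSq_add_max (L := offDiag φ ((reTrace A X)⁻¹ • X)) hC (h _)
    ((Fintype.card B : ℝ)⁻¹ • (1 : Matrix B B ℂ))
  have := mul_le_mul_of_nonneg_left (Matrix.PosSemidef.perspective_sum_le hf hY)
    (Complex.nonneg_iff.1 hX.trace_nonneg).1
  simp only [Finset.mul_sum, sub_right_comm c (frobSq (_ - (Fintype.card B : ℝ)⁻¹ • 1))] at this
  exact this

/-- The potential is bounded by a multiple of the error of guessing `g` at once. -/
theorem potential_guess_le {φ : ι → EuclideanSpace ℂ (A × B)} (hφ : ∀ j, ‖φ j‖ = 1)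
    {C c η : ℝ} (hC : 0 ≤ C) (hη : 0 < η) (hc : 0 < c)
    (hdiag : ∀ x y, frobSq (x - (Fintype.card A : ℝ)⁻¹ • (1 : Matrix A A ℂ)) < c →
      frobSq (y - (Fintype.card B : ℝ)⁻¹ • (1 : Matrix B B ℂ)) < c →
      ∀ j, η ≤ (inner ℂ (φ j) (actFst x (actSnd y (φ j)))).re)
    {A' B' : Type} [Fintype A'] [Fintype B'] (α : Matrix A' A ℂ) (β : Matrix B' B ℂ)
    {g i : ι} (hi : i ≠ g) :
    potential φ C c (αᴴ * α) (βᴴ * β) ≤ (C * Fintype.card ι ^ 2 + c / η) *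
      ∑ j ∈ Finset.univ.erase g, ‖actFst α (actSnd β (φ j))‖ ^ 2 := by
  set G := ∑ j ∈ Finset.univ.erase g, ‖actFst α (actSnd β (φ j))‖ ^ 2 with hG
  have hG0 : 0 ≤ G := Finset.sum_nonneg fun _ _ => sq_nonneg _
  have hle : ∀ j, j ≠ g → ‖actFst α (actSnd β (φ j))‖ ^ 2 ≤ G := fun j hj =>
    Finset.single_le_sum (f := fun j => ‖actFst α (actSnd β (φ j))‖ ^ 2)
      (fun _ _ => sq_nonneg _) (Finset.mem_erase.2 ⟨hj, Finset.mem_univ _⟩)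
  have ht : reTrace A (αᴴ * α) = frobSq α := by
    rw [reTrace_apply, trace_conjTranspose_mul_self, Complex.ofReal_re]
  have hs : reTrace B (βᴴ * β) = frobSq β := by
    rw [reTrace_apply, trace_conjTranspose_mul_self, Complex.ofReal_re]
  rw [potential, ht, hs]
  rcases (frobSq_nonneg α).eq_or_lt with h0 | htp
  · rw [← h0, zero_mul]; positivity
  rcases (frobSq_nonneg β).eq_or_lt with h0 | hsp
  · rw [← h0, zero_mul, mul_zero]; positivity
  set t := frobSq α
  set s := frobSq β
  have hnorm : ∀ j, ‖actFst α (actSnd β (φ j))‖ ^ 2 ≤ t * s := fun j => by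
    refine (norm_sq_actFst_le _ _).trans (mul_le_mul_of_nonneg_left ?_ htp.le)
    simpa [hφ j] using norm_sq_actSnd_le β (φ j)
  -- of two different states, at least one differs from `g` and so contributes to `G`
  have hoff : frobSq (offDiag φ (αᴴ * α) (βᴴ * β)) ≤ Fintype.card ι ^ 2 * (t * s * G) := by
    have : ∀ j k, ‖offDiag φ (αᴴ * α) (βᴴ * β) j k‖ ^ 2 ≤ t * s * G := fun j k => by
      rw [offDiag_apply]
      split_ifs with h
      · rw [norm_zero, zero_pow two_ne_zero]; positivity
      · rw [inner_actFst_actSnd_gram]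
        refine (pow_le_pow_left₀ (norm_nonneg _) (norm_inner_le_norm _ _) 2).trans ?_
        rw [mul_pow]
        by_cases hj : j = g
        · exact mul_le_mul (hnorm j) (hle k fun hk => h (hj.trans hk.symm)) (sq_nonneg _)
            (by positivity)
        · rw [mul_comm]
          exact mul_le_mul (hnorm k) (hle j hj) (sq_nonneg _) (by positivity)
    calc frobSq (offDiag φ (αᴴ * α) (βᴴ * β)) ≤ ∑ _j : ι, ∑ _k : ι, t * s * G :=
          Finset.sum_le_sum fun j _ => Finset.sum_le_sum fun k _ => this j k
      _ = Fintype.card ι ^ 2 * (t * s * G) := by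
          simp only [Finset.sum_const, Finset.card_univ, nsmul_eq_mul]; ring
  have h1 : t * (s * (C * frobSq (offDiag φ (t⁻¹ • (αᴴ * α)) (s⁻¹ • (βᴴ * β))))) ≤
      C * Fintype.card ι ^ 2 * G := by
    rw [LinearMap.map_smul_of_tower, LinearMap.map_smul_of_tower (offDiag φ),
      LinearMap.smul_apply, frobSq_smul, frobSq_smul]
    calc _ = C * (t * s)⁻¹ * frobSq (offDiag φ (αᴴ * α) (βᴴ * β)) := by field_simp
      _ ≤ C * (t * s)⁻¹ * (Fintype.card ι ^ 2 * (t * s * G)) := by gcongr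
      _ = _ := by field_simp
  have h2 : t * (s * max 0 (c
      - frobSq (t⁻¹ • (αᴴ * α) - (Fintype.card A : ℝ)⁻¹ • (1 : Matrix A A ℂ))
      - frobSq (s⁻¹ • (βᴴ * β) - (Fintype.card B : ℝ)⁻¹ • (1 : Matrix B B ℂ)))) ≤ c / η * G := by
    set a := frobSq (t⁻¹ • (αᴴ * α) - (Fintype.card A : ℝ)⁻¹ • (1 : Matrix A A ℂ)) with ha
    set b := frobSq (s⁻¹ • (βᴴ * β) - (Fintype.card B : ℝ)⁻¹ • (1 : Matrix B B ℂ)) with hb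
    have ha0 : 0 ≤ a := frobSq_nonneg _
    have hb0 : 0 ≤ b := frobSq_nonneg _
    rcases le_or_gt (c - a - b) 0 with hneg | hpos
    · rw [max_eq_left hneg, mul_zero, mul_zero]; positivity
    · -- `x` and `y` are close to multiples of `1`, so the state `φ i` with `i ≠ g` is still likely
      have hd := hdiag _ _ (show a < c by linarith) (show b < c by linarith) i
      have hv : (inner ℂ (φ i) (actFst (t⁻¹ • (αᴴ * α)) (actSnd (s⁻¹ • (βᴴ * β)) (φ i)))).re =
          t⁻¹ * (s⁻¹ * ‖actFst α (actSnd β (φ i))‖ ^ 2) := by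
        rw [← Complex.coe_smul, ← Complex.coe_smul s⁻¹, actFst_smul, actSnd_smul,
          actFst_vec_smul, inner_smul_right, inner_smul_right, inner_actFst_actSnd_gram,
          Complex.re_ofReal_mul, Complex.re_ofReal_mul, ← inner_self_eq_norm_sq (𝕜 := ℂ)]
        rfl
      rw [hv] at hd
      have hts : η * (t * s) ≤ G := by
        calc η * (t * s) ≤ t⁻¹ * (s⁻¹ * ‖actFst α (actSnd β (φ i))‖ ^ 2) * (t * s) := by gcongr
          _ = ‖actFst α (actSnd β (φ i))‖ ^ 2 := by field_simp
          _ ≤ G := hle i hi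
      rw [max_eq_right hpos.le]
      calc t * (s * (c - a - b)) ≤ t * (s * c) := by gcongr; linarith
        _ = c / η * (η * (t * s)) := by field_simp
        _ ≤ c / η * G := by gcongr
  rw [normalizedPotential]
  linarith

theorem exists_le_frobSq_offDiag_left [Nonempty A] (φ : ι → EuclideanSpace ℂ (A × B))
    (hA : ∀ X : Matrix A A ℂ, (∀ j k, j ≠ k → inner ℂ (φ j) (actFst X (φ k)) = 0) →
      ∃ c : ℂ, X = c • (1 : Matrix A A ℂ)) {r : ℝ} (hr : r ≠ 0) :
    ∃ κ > 0, ∀ᶠ y in 𝓝 (r • (1 : Matrix B B ℂ)), ∀ D, D.trace = 0 →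
      κ * frobSq D ≤ frobSq (offDiag φ D y) := by
  refine exists_eventually_le_frobSq (offDiag φ) (continuous_offDiag φ) _
    fun D hD h => eq_zero_of_trace_of_scalar (hA D fun j k hjk => ?_) hD
  have := congrFun (congrFun h j) k
  rw [offDiag_apply, if_neg hjk, actSnd_real_smul_one, actFst_vec_smul, inner_smul_right] at this
  exact (mul_eq_zero.1 this).resolve_left (by exact_mod_cast hr)

theorem exists_le_frobSq_offDiag_right [Nonempty B] (φ : ι → EuclideanSpace ℂ (A × B))
    (hB : ∀ Y : Matrix B B ℂ, (∀ j k, j ≠ k → inner ℂ (φ j) (actSnd Y (φ k)) = 0) →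
      ∃ c : ℂ, Y = c • (1 : Matrix B B ℂ)) {r : ℝ} (hr : r ≠ 0) :
    ∃ κ > 0, ∀ᶠ x in 𝓝 (r • (1 : Matrix A A ℂ)), ∀ D, D.trace = 0 →
      κ * frobSq D ≤ frobSq (offDiag φ x D) := by
  refine exists_eventually_le_frobSq (offDiag φ).flip
    (by simpa only [LinearMap.flip_apply, Function.comp_def, Prod.fst_swap, Prod.snd_swap]
      using (continuous_offDiag φ).comp continuous_swap) _
    fun D hD h => eq_zero_of_trace_of_scalar (hB D fun j k hjk => ?_) hD
  have := congrFun (congrFun h j) k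
  rw [LinearMap.flip_apply, offDiag_apply, if_neg hjk, actFst_real_smul_one,
    inner_smul_right] at this
  exact (mul_eq_zero.1 this).resolve_left (by exact_mod_cast hr)

/-- The constants of the potential: a radius `c` of the neighbourhoods of the multiples of `1` and a
factor `C` such that the lower bounds for `offDiag` and for the diagonal entries hold there. -/
theorem exists_constants [Nonempty A] [Nonempty B] {φ : ι → EuclideanSpace ℂ (A × B)}
    (hφ : ∀ j, ‖φ j‖ = 1)
    (hA : ∀ X : Matrix A A ℂ, (∀ j k, j ≠ k → inner ℂ (φ j) (actFst X (φ k)) = 0) →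
      ∃ c : ℂ, X = c • (1 : Matrix A A ℂ))
    (hB : ∀ Y : Matrix B B ℂ, (∀ j k, j ≠ k → inner ℂ (φ j) (actSnd Y (φ k)) = 0) →
      ∃ c : ℂ, Y = c • (1 : Matrix B B ℂ)) {r s : ℝ} (hr : 0 < r) (hs : 0 < s) :
    ∃ C > 0, ∃ c > 0,
      (∀ y : Matrix B B ℂ, frobSq (y - s • (1 : Matrix B B ℂ)) < c →
        ∀ D, D.trace = 0 → frobSq D ≤ C * frobSq (offDiag φ D y)) ∧
      (∀ x : Matrix A A ℂ, frobSq (x - r • (1 : Matrix A A ℂ)) < c →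
        ∀ D, D.trace = 0 → frobSq D ≤ C * frobSq (offDiag φ x D)) ∧
      ∀ x y, frobSq (x - r • (1 : Matrix A A ℂ)) < c → frobSq (y - s • (1 : Matrix B B ℂ)) < c →
        ∀ j, r * s / 2 ≤ (inner ℂ (φ j) (actFst x (actSnd y (φ j)))).re := by
  obtain ⟨κ₁, hκ₁, hev₁⟩ := exists_le_frobSq_offDiag_left φ hA hs.ne'
  obtain ⟨κ₂, hκ₂, hev₂⟩ := exists_le_frobSq_offDiag_right φ hB hr.ne'
  have hev₃ := eventually_half_lt_inner hφ hr hs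
  rw [nhds_prod_eq, eventually_prod_iff] at hev₃
  obtain ⟨pa, hpa, pb, hpb, hp⟩ := hev₃
  obtain ⟨c₁, hc₁, H₁⟩ := exists_frobSq_lt_imp (hev₂.and hpa)
  obtain ⟨c₂, hc₂, H₂⟩ := exists_frobSq_lt_imp (hev₁.and hpb)
  have hle : ∀ {κ u v : ℝ}, 0 < κ → κ⁻¹ ≤ max κ₁⁻¹ κ₂⁻¹ → 0 ≤ v → κ * u ≤ v →
      u ≤ max κ₁⁻¹ κ₂⁻¹ * v := fun {κ u v} hκ hκC hv h => by
    calc u = κ⁻¹ * (κ * u) := by field_simp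
      _ ≤ κ⁻¹ * v := by gcongr
      _ ≤ _ := by gcongr
  refine ⟨max κ₁⁻¹ κ₂⁻¹, lt_max_of_lt_left (inv_pos.2 hκ₁), min c₁ c₂, lt_min hc₁ hc₂,
    fun y hy D hD => ?_, fun x hx D hD => ?_, fun x y hx hy j => ?_⟩
  · exact hle hκ₁ (le_max_left _ _) (frobSq_nonneg _)
      ((H₂ y (hy.trans_le (min_le_right _ _))).1 D hD)
  · exact hle hκ₂ (le_max_right _ _) (frobSq_nonneg _)
      ((H₁ x (hx.trans_le (min_le_left _ _))).1 D hD)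
  · exact (hp (H₁ x (hx.trans_le (min_le_left _ _))).2
      (H₂ y (hy.trans_le (min_le_right _ _))).2 j).le

theorem potential_one_one [Nonempty A] [Nonempty B] {φ : ι → EuclideanSpace ℂ (A × B)}
    (hφ : Orthonormal ℂ φ) (C : ℝ) {c : ℝ} (hc : 0 ≤ c) :
    potential φ C c 1 1 = Fintype.card A * (Fintype.card B * c) := by
  have h0 : offDiag φ ((Fintype.card A : ℝ)⁻¹ • (1 : Matrix A A ℂ))
      ((Fintype.card B : ℝ)⁻¹ • (1 : Matrix B B ℂ)) = 0 := by
    ext j k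
    rw [offDiag_apply, actFst_real_smul_one, actSnd_real_smul_one]
    split_ifs with h
    · rfl
    · rw [inner_smul_right, inner_smul_right, hφ.2 h, mul_zero, mul_zero]
      rfl
  have hrA : reTrace A 1 = Fintype.card A := by simp [reTrace_apply]
  have hrB : reTrace B 1 = Fintype.card B := by simp [reTrace_apply]
  rw [potential, normalizedPotential, hrA, hrB, h0, sub_self, sub_self,
    frobSq_eq_zero.2 rfl, frobSq_eq_zero.2 rfl, frobSq_eq_zero.2 rfl, mul_zero, zero_add,
    sub_zero, sub_zero, max_eq_right hc]

/-- If a family of orthonormal states admits only trivial orthogonality-preserving effects on both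
sides, then the total error of LOCC protocols is bounded away from `0`. -/
theorem exists_forall_le_error [Nonempty A] [Nonempty B] [Nontrivial ι]
    {φ : ι → EuclideanSpace ℂ (A × B)} (hφ : Orthonormal ℂ φ)
    (hA : ∀ X : Matrix A A ℂ, (∀ j k, j ≠ k → inner ℂ (φ j) (actFst X (φ k)) = 0) →
      ∃ c : ℂ, X = c • (1 : Matrix A A ℂ))
    (hB : ∀ Y : Matrix B B ℂ, (∀ j k, j ≠ k → inner ℂ (φ j) (actSnd Y (φ k)) = 0) →
      ∃ c : ℂ, Y = c • (1 : Matrix B B ℂ)) :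
    ∃ ε > 0, ∀ P : LOCC ι A B, ε ≤ ∑ j, (1 - P.prob j (φ j)) := by
  have hcA : (0 : ℝ) < Fintype.card A := by exact_mod_cast Fintype.card_pos
  have hcB : (0 : ℝ) < Fintype.card B := by exact_mod_cast Fintype.card_pos
  obtain ⟨C, hC, c, hc, h₁, h₂, h₃⟩ :=
    exists_constants hφ.1 hA hB (inv_pos.2 hcA) (inv_pos.2 hcB)
  have hη : 0 < (Fintype.card A : ℝ)⁻¹ * (Fintype.card B : ℝ)⁻¹ / 2 := by positivity
  generalize (Fintype.card A : ℝ)⁻¹ * (Fintype.card B : ℝ)⁻¹ / 2 = η at h₃ hη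
  obtain ⟨M, hM⟩ : ∃ M, M = C * (Fintype.card ι : ℝ) ^ 2 + c / η := ⟨_, rfl⟩
  have hM0 : 0 < M := by rw [hM]; positivity
  refine ⟨M⁻¹ * (Fintype.card A * (Fintype.card B * c)), by positivity, fun P => ?_⟩
  have key := LOCC.le_error φ (fun X Y => M⁻¹ * potential φ C c X Y) ?_ ?_ ?_ P 1 1
  · simpa only [conjTranspose_one, mul_one, actFst_one, actSnd_one, hφ.1, one_pow,
      potential_one_one hφ C hc.le] using key
  · intro A' B' _ _ α β g
    obtain ⟨i, hi⟩ := exists_ne g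
    rw [inv_mul_le_iff₀ hM0, hM]
    exact potential_guess_le hφ.1 hC.le hη hc h₃ α β hi
  · intro κ _ X Y hX hY
    rw [← Finset.mul_sum]
    exact mul_le_mul_of_nonneg_left (potential_sum_left_le hC.le h₁ hX hY) (inv_nonneg.2 hM0.le)
  · intro κ _ X Y hX hY
    rw [← Finset.mul_sum]
    exact mul_le_mul_of_nonneg_left (potential_sum_right_le hC.le h₂ hX hY) (inv_nonneg.2 hM0.le)

theorem not_LOCCDistinguishable [Nonempty A] [Nonempty B] [Nontrivial ι]
    {φ : ι → EuclideanSpace ℂ (A × B)} (hφ : Orthonormal ℂ φ)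
    (hA : ∀ X : Matrix A A ℂ, (∀ j k, j ≠ k → inner ℂ (φ j) (actFst X (φ k)) = 0) →
      ∃ c : ℂ, X = c • (1 : Matrix A A ℂ))
    (hB : ∀ Y : Matrix B B ℂ, (∀ j k, j ≠ k → inner ℂ (φ j) (actSnd Y (φ k)) = 0) →
      ∃ c : ℂ, Y = c • (1 : Matrix B B ℂ)) :
    ¬ LOCCDistinguishable φ := by
  rintro ⟨P, -, hP⟩
  obtain ⟨ε, hε, h⟩ := exists_forall_le_error hφ hA hB
  have hlim : Tendsto (fun n => ∑ j, (1 - (P n).prob j (φ j))) atTop (𝓝 (∑ _j : ι, (1 - 1))) :=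
    tendsto_finsetSum _ fun j _ => (hP j).const_sub 1
  have := ge_of_tendsto' hlim fun n => h (P n)
  simp at this
  linarith

end bound

/-! ### Product bases with connected overlaps -/

/-- The product vector `a ⊗ b` in the space of two parties. -/
noncomputable def prodVec {A B : Type} (a : EuclideanSpace ℂ A) (b : EuclideanSpace ℂ B) :
    EuclideanSpace ℂ (A × B) :=
  WithLp.toLp 2 fun p => a p.1 * b p.2

section prodVec
variable {A B : Type} [Fintype A] [Fintype B]

theorem inner_prodVec (a a' : EuclideanSpace ℂ A) (b b' : EuclideanSpace ℂ B) :
    inner ℂ (prodVec a b) (prodVec a' b') = inner ℂ a a' * inner ℂ b b' := by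
  simp only [prodVec, PiLp.inner_apply, RCLike.inner_apply, Fintype.sum_prod_type,
    Finset.sum_mul_sum, map_mul]
  exact Finset.sum_congr rfl fun _ _ => Finset.sum_congr rfl fun _ _ => by ring

theorem norm_prodVec (a : EuclideanSpace ℂ A) (b : EuclideanSpace ℂ B) :
    ‖prodVec a b‖ = ‖a‖ * ‖b‖ := by
  have h := inner_prodVec a a b b
  simp only [inner_self_eq_norm_sq_to_K] at h
  have h' : ‖prodVec a b‖ ^ 2 = (‖a‖ * ‖b‖) ^ 2 := by
    rw [mul_pow]
    exact_mod_cast h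
  exact (sq_eq_sq₀ (norm_nonneg _) (by positivity)).1 h'

theorem actFst_prodVec {A B : Type} [Fintype A] (X : Matrix A A ℂ)
    (a : EuclideanSpace ℂ A) (b : EuclideanSpace ℂ B) :
    actFst X (prodVec a b) = prodVec (WithLp.toLp 2 (X *ᵥ a)) b := by
  ext p
  simp [actFst, prodVec, Matrix.mulVec, dotProduct, Finset.sum_mul, mul_assoc]

end prodVec

theorem eq_of_forall_inner_eq {E ι : Type} [NormedAddCommGroup E] [InnerProductSpace ℂ E]
    {φ : ι → E} (hspan : Submodule.span ℂ (Set.range φ) = ⊤) {u v : E}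
    (h : ∀ j, inner ℂ (φ j) u = inner ℂ (φ j) v) : u = v := by
  refine ext_inner_left ℂ fun w => ?_
  have hw : w ∈ Submodule.span ℂ (Set.range φ) := hspan ▸ Submodule.mem_top
  induction hw using Submodule.span_induction with
  | mem x hx => obtain ⟨j, rfl⟩ := hx; exact h j
  | zero => simp
  | add x y _ _ hx hy => rw [inner_add_left, inner_add_left, hx, hy]
  | smul c x _ hx => rw [inner_smul_left, inner_smul_left, hx]

/-- The graph that joins `j` and `k` if `a j` and `a k` are not orthogonal is connected. -/
def OverlapConnected {ι E : Type} [NormedAddCommGroup E] [InnerProductSpace ℂ E]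
    (a : ι → E) : Prop :=
  ∀ j k, Relation.ReflTransGen (fun j k => inner ℂ (a j) (a k) ≠ 0) j k

/-- If the overlaps of the first factors of an orthonormal product basis are connected, only scalar
operators of the first party have no off-diagonal entries. -/
theorem exists_eq_smul_one_of_actFst {A B ι : Type} [Fintype A] [DecidableEq A] [Fintype B]
    [Nonempty B] [Nonempty ι] {φ : ι → EuclideanSpace ℂ (A × B)} (hφ : Orthonormal ℂ φ)
    (hspan : Submodule.span ℂ (Set.range φ) = ⊤) {a : ι → EuclideanSpace ℂ A}
    {b : ι → EuclideanSpace ℂ B} (hab : ∀ j, φ j = prodVec (a j) (b j))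
    (ha : OverlapConnected a) (X : Matrix A A ℂ)
    (hX : ∀ j k, j ≠ k → inner ℂ (φ j) (actFst X (φ k)) = 0) :
    ∃ c : ℂ, X = c • (1 : Matrix A A ℂ) := by
  classical
  -- the product vectors `φ j` are eigenvectors of `X ⊗ 1` and of its adjoint
  have hφX : ∀ k, actFst X (φ k) = inner ℂ (φ k) (actFst X (φ k)) • φ k := fun k => by
    refine eq_of_forall_inner_eq hspan fun j => ?_
    rw [inner_smul_right]
    by_cases h : j = k
    · rw [h, inner_self_eq_norm_sq_to_K, hφ.1 k]; simp
    · rw [hX j k h, hφ.2 h, mul_zero]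
  have hφX' : ∀ k, actFst Xᴴ (φ k) = inner ℂ (actFst X (φ k)) (φ k) • φ k := fun k => by
    refine eq_of_forall_inner_eq hspan fun j => ?_
    rw [inner_smul_right, ← inner_actFst]
    by_cases h : j = k
    · rw [h, inner_self_eq_norm_sq_to_K, hφ.1 k]; simp
    · rw [← inner_conj_symm, hX k j (Ne.symm h), hφ.2 h, mul_zero, map_zero]
  have hconst : ∀ j k, inner ℂ (φ j) (actFst X (φ j)) = inner ℂ (φ k) (actFst X (φ k)) := by
    intro j k
    induction ha j k with
    | refl => rfl
    | @tail l m _ hlm ih =>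
      rw [ih]
      have hne : ∀ i, a i ≠ 0 ∧ b i ≠ 0 := fun i => by
        have := hφ.1 i
        rw [hab, norm_prodVec] at this
        constructor <;> rintro h <;> simp [h] at this
      -- evaluate `X ⊗ 1` between `a l ⊗ b m` and `a m ⊗ b m`, acting to the right;
      -- and between `a l ⊗ b l` and `a m ⊗ b l`, acting to the left
      have h1 := congrArg (inner ℂ (prodVec (a l) (b m))) (hφX m)
      have h2 := congrArg (fun v => inner ℂ v (prodVec (a m) (b l))) (hφX' l)
      have hbb : ∀ i, inner ℂ (b i) (b i) ≠ 0 := fun i => inner_self_ne_zero.2 (hne i).2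
      generalize inner ℂ (φ m) (actFst X (φ m)) = μ at h1 ⊢
      simp only [inner_smul_left, inner_conj_symm] at h2
      generalize inner ℂ (φ l) (actFst X (φ l)) = ν at h2 ⊢
      rw [inner_smul_right, hab m, inner_prodVec, actFst_prodVec, inner_prodVec] at h1
      rw [inner_actFst, conjTranspose_conjTranspose, hab l, inner_prodVec, actFst_prodVec,
        inner_prodVec] at h2
      rw [← mul_assoc] at h1 h2
      have h1' := mul_right_cancel₀ (hbb m) h1
      have h2' := mul_right_cancel₀ (hbb l) h2
      exact mul_right_cancel₀ hlm (h2'.symm.trans h1')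
  obtain ⟨j₀⟩ := ‹Nonempty ι›
  refine ⟨inner ℂ (φ j₀) (actFst X (φ j₀)), ?_⟩
  generalize hμ : inner ℂ (φ j₀) (actFst X (φ j₀)) = μ
  have hact : ∀ v, actFst X v = (μ • v : EuclideanSpace ℂ (A × B)) := fun v => by
    have hv : v ∈ Submodule.span ℂ (Set.range φ) := hspan ▸ Submodule.mem_top
    induction hv using Submodule.span_induction with
    | mem x hx => obtain ⟨j, rfl⟩ := hx; rw [hφX, hconst j j₀, hμ]
    | zero => ext; simp [actFst]
    | add x y _ _ hx hy => rw [actFst_vec_add, hx, hy, smul_add]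
    | smul c x _ hx => rw [actFst_vec_smul, hx, smul_comm]
  obtain ⟨y₀⟩ := ‹Nonempty B›
  ext x x'
  have := congrArg (fun v : EuclideanSpace ℂ (A × B) => v (x, y₀))
    (hact (prodVec (EuclideanSpace.single x' 1) (WithLp.toLp 2 fun _ => 1)))
  simpa [actFst, prodVec, Matrix.one_apply, Pi.single_apply] using this

/-- The exchange of the two parties. -/
noncomputable def swapParties {A B : Type} (v : EuclideanSpace ℂ (A × B)) :
    EuclideanSpace ℂ (B × A) :=
  WithLp.toLp 2 fun p => v p.swap

theorem inner_swapParties {A B : Type} [Fintype A] [Fintype B] (u v : EuclideanSpace ℂ (A × B)) :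
    inner ℂ (swapParties u) (swapParties v) = inner ℂ u v := by
  simp only [PiLp.inner_apply, swapParties]
  exact (Equiv.prodComm B A).sum_comp fun p => inner ℂ (u p) (v p)

/-- `swapParties` as a linear equivalence. -/
noncomputable def swapPartiesₗ (A B : Type) :
    EuclideanSpace ℂ (A × B) ≃ₗ[ℂ] EuclideanSpace ℂ (B × A) where
  toFun := swapParties
  invFun := swapParties
  map_add' _ _ := rfl
  map_smul' _ _ := rfl
  left_inv _ := rfl
  right_inv _ := rfl

theorem exists_eq_smul_one_of_actSnd {A B ι : Type} [Fintype A] [Fintype B] [DecidableEq B]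
    [Nonempty A] [Nonempty ι] {φ : ι → EuclideanSpace ℂ (A × B)} (hφ : Orthonormal ℂ φ)
    (hspan : Submodule.span ℂ (Set.range φ) = ⊤) {a : ι → EuclideanSpace ℂ A}
    {b : ι → EuclideanSpace ℂ B} (hab : ∀ j, φ j = prodVec (a j) (b j))
    (hb : OverlapConnected b) (Y : Matrix B B ℂ)
    (hY : ∀ j k, j ≠ k → inner ℂ (φ j) (actSnd Y (φ k)) = 0) :
    ∃ c : ℂ, Y = c • (1 : Matrix B B ℂ) := by
  refine exists_eq_smul_one_of_actFst (φ := fun j => swapParties (φ j)) (a := b) (b := a)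
    ?_ ?_ (fun j => ?_) hb Y fun j k hjk => ?_
  · classical
    rw [orthonormal_iff_ite] at hφ ⊢
    simpa only [inner_swapParties] using hφ
  · have := congrArg (Submodule.map (swapPartiesₗ A B).toLinearMap) hspan
    rw [Submodule.map_span, Submodule.map_top, LinearEquiv.range, ← Set.range_comp] at this
    exact this
  · rw [hab]
    ext p
    simp [swapParties, prodVec, mul_comm]
  · exact (inner_swapParties (φ j) (actSnd Y (φ k))).trans (hY j k hjk)

/-! ### The 27 states -/

/-- The product vector `⨂ i, f i` in the space of a finite set of parties. -/
noncomputable def tensorVec {I : Type} [Fintype I] {d : ℕ} (f : I → EuclideanSpace ℂ (Fin d)) :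
    EuclideanSpace ℂ (I → Fin d) :=
  WithLp.toLp 2 fun y => ∏ i, f i (y i)

theorem inner_tensorVec {I : Type} [Fintype I] [DecidableEq I] {d : ℕ}
    (f g : I → EuclideanSpace ℂ (Fin d)) :
    inner ℂ (tensorVec f) (tensorVec g) = ∏ i, inner ℂ (f i) (g i) := by
  simp only [tensorVec, PiLp.inner_apply, RCLike.inner_apply, Fintype.prod_sum, map_prod,
    Finset.prod_mul_distrib]

theorem inner_cut {d : ℕ} (p : Fin 3) (u v : TripartiteSpace d) :
    inner ℂ (cut p u) (cut p v) = inner ℂ u v := by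
  simp only [PiLp.inner_apply, cut]
  exact (Equiv.piSplitAt p fun _ => Fin d).symm.sum_comp fun x => inner ℂ (u x) (v x)

/-- `cut` as a linear equivalence. -/
noncomputable def cutₗ (d : ℕ) (p : Fin 3) : TripartiteSpace d ≃ₗ[ℂ]
    EuclideanSpace ℂ (Fin d × ({q : Fin 3 // q ≠ p} → Fin d)) where
  toFun := cut p
  invFun v := WithLp.toLp 2 fun x => v ((Equiv.piSplitAt p fun _ => Fin d) x)
  map_add' _ _ := rfl
  map_smul' _ _ := rfl
  left_inv v := by ext x; exact congrArg v.ofLp (Equiv.symm_apply_apply _ x)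
  right_inv v := by ext x; simp [cut]

theorem orthonormal_cut {d : ℕ} {ι : Type} {ψ : ι → TripartiteSpace d} (hψ : Orthonormal ℂ ψ)
    (p : Fin 3) : Orthonormal ℂ fun j => cut p (ψ j) := by
  classical
  rw [orthonormal_iff_ite] at hψ ⊢
  simpa only [inner_cut] using hψ

theorem span_range_cut {d : ℕ} {ι : Type} {ψ : ι → TripartiteSpace d}
    (hψ : Submodule.span ℂ (Set.range ψ) = ⊤) (p : Fin 3) :
    Submodule.span ℂ (Set.range fun j => cut p (ψ j)) = ⊤ := by
  have := congrArg (Submodule.map (cutₗ d p).toLinearMap) hψ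
  rw [Submodule.map_span, Submodule.map_top, LinearEquiv.range, ← Set.range_comp] at this
  exact this

theorem cut_tensorVec {d : ℕ} (p : Fin 3) (f : Fin 3 → EuclideanSpace ℂ (Fin d)) :
    cut p (tensorVec f) = prodVec (f p) (tensorVec fun q : {q : Fin 3 // q ≠ p} => f q) := by
  ext ⟨x, y⟩
  simp only [cut, tensorVec, prodVec]
  rw [Fintype.prod_eq_mul_prod_subtype_ne _ p]
  congr 1
  · simp [Equiv.piSplitAt]
  · refine Finset.prod_congr rfl fun q _ => ?_
    simp [Equiv.piSplitAt, q.2]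

/-- Labels of the seven local states `|k⟩`, `|η_s⟩` and `|ξ_s⟩`. They make the relations among
the basis states decidable. -/
inductive LocalState
  | ket (k : Fin 3)
  | eta (s : ℤˣ)
  | xi (s : ℤˣ)

namespace LocalState

/-- The vector that a label stands for. -/
noncomputable def vec : LocalState → EuclideanSpace ℂ (Fin 3)
  | ket k => _root_.ket k
  | eta s => ketEta s
  | xi s => ketXi s

/-- Whether the vectors of two labels are not orthogonal. -/
def overlaps : LocalState → LocalState → Bool
  | ket i, ket j => i = j
  | eta s, eta t => s = t
  | xi s, xi t => s = t
  | eta _, xi _ => true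
  | xi _, eta _ => true
  | ket i, eta _ => i ≠ 2
  | eta _, ket i => i ≠ 2
  | ket i, xi _ => i ≠ 0
  | xi _, ket i => i ≠ 0

theorem norm_vec (l : LocalState) : ‖l.vec‖ = 1 := by
  rcases l with i | s | s <;>
    (try rcases Int.units_eq_one_or s with rfl | rfl) <;>
  simp [vec, _root_.ket, ketEta, ketXi, EuclideanSpace.norm_eq, Fin.sum_univ_three] <;>
  norm_num

theorem inner_vec_eq_zero_iff (l m : LocalState) :
    inner ℂ l.vec m.vec = 0 ↔ overlaps l m = false := by
  by_cases hlm : l = m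
  · subst hlm
    refine iff_of_false (fun h => ?_) (by cases l <;> simp [overlaps])
    have := norm_vec l
    rw [inner_self_eq_zero.1 h, norm_zero] at this
    exact zero_ne_one this
  · rcases l with i | s | s <;> rcases m with j | t | t <;>
      (try fin_cases i) <;> (try fin_cases j) <;>
      (try rcases Int.units_eq_one_or s with rfl | rfl) <;>
      (try rcases Int.units_eq_one_or t with rfl | rfl) <;>
      first
      | exact absurd rfl hlm
      | simp [vec, overlaps, _root_.ket, ketEta, ketXi, PiLp.inner_apply]

end LocalState

open LocalState in
/-- The labels of the three factors of each basis state. -/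
def basisIIFactors : (Fin 6 × ℤˣ × ℤˣ) ⊕ Fin 3 → Fin 3 → LocalState
  | .inl (0, s, t) => ![ket 0, eta s, xi t]
  | .inl (1, s, t) => ![eta s, ket 2, xi t]
  | .inl (2, s, t) => ![ket 2, xi s, eta t]
  | .inl (3, s, t) => ![eta s, xi t, ket 0]
  | .inl (4, s, t) => ![xi s, ket 0, eta t]
  | .inl (5, s, t) => ![xi s, eta t, ket 2]
  | .inr k => ![ket k, ket k, ket k]

theorem basisII_eq_tensorVec (i : (Fin 6 × ℤˣ × ℤˣ) ⊕ Fin 3) :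
    basisII i = tensorVec fun q => (basisIIFactors i q).vec := by
  rcases i with ⟨g, s, t⟩ | k
  · fin_cases g <;>
    · ext x
      simp [basisII, tripleProduct, tensorVec, basisIIFactors, LocalState.vec, Fin.prod_univ_three]
  · ext x
    simp [basisII, tripleProduct, tensorVec, basisIIFactors, LocalState.vec, Fin.prod_univ_three]

set_option maxRecDepth 100000 in
/-- Any two basis states are orthogonal at some party. -/
theorem exists_not_overlaps : ∀ i j, i ≠ j →
    ∃ q, (basisIIFactors i q).overlaps (basisIIFactors j q) = false := by
  decide

set_option maxRecDepth 100000 in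
/-- At a single party, every factor is joined to `|1⟩` by a path of length two. -/
theorem overlaps_path_party : ∀ p i, ∃ j, (basisIIFactors j p).overlaps (.ket 1) = true ∧
    (basisIIFactors i p).overlaps (basisIIFactors j p) = true := by
  decide

set_option maxRecDepth 100000 in
/-- At two parties together, every product of factors is joined to `|1⟩|1⟩` by a path of length
three. -/
theorem overlaps_path_others : ∀ p i, ∃ j,
    (∀ q, q ≠ p → (basisIIFactors j q).overlaps (.ket 1) = true) ∧
    ∃ k, (∀ q, q ≠ p → (basisIIFactors k q).overlaps (basisIIFactors j q) = true) ∧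
    (∀ q, q ≠ p → (basisIIFactors i q).overlaps (basisIIFactors k q) = true) := by
  decide

theorem orthonormal_basisII : Orthonormal ℂ basisII := by
  rw [orthonormal_iff_ite]
  intro i j
  simp only [basisII_eq_tensorVec, inner_tensorVec]
  split_ifs with h
  · subst h
    refine Finset.prod_eq_one fun q _ => ?_
    rw [inner_self_eq_norm_sq_to_K, LocalState.norm_vec]
    simp
  · obtain ⟨q, hq⟩ := exists_not_overlaps i j h
    exact Finset.prod_eq_zero (Finset.mem_univ q) ((LocalState.inner_vec_eq_zero_iff _ _).2 hq)

theorem span_basisII : Submodule.span ℂ (Set.range basisII) = ⊤ := by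
  refine orthonormal_basisII.linearIndependent.span_eq_top_of_card_eq_finrank' ?_
  simp [Fintype.card_units_int]

theorem inner_vec_ne_zero {l m : LocalState} (h : l.overlaps m = true) :
    inner ℂ l.vec m.vec ≠ 0 := by
  rw [Ne, LocalState.inner_vec_eq_zero_iff, h]
  exact Bool.true_eq_false_eq_False.elim

/-- It suffices that each vertex is joined to one vertex `h` by a path of length three. -/
theorem OverlapConnected.of_hub {ι E : Type} [NormedAddCommGroup E] [InnerProductSpace ℂ E]
    {a : ι → E} {h : ι}
    (H : ∀ i, ∃ j k, inner ℂ (a i) (a k) ≠ 0 ∧ inner ℂ (a k) (a j) ≠ 0 ∧ inner ℂ (a j) (a h) ≠ 0) :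
    OverlapConnected a := by
  have hub : ∀ i, Relation.ReflTransGen (fun j k => inner ℂ (a j) (a k) ≠ 0) i h := fun i => by
    obtain ⟨j, k, hik, hkj, hjh⟩ := H i
    exact .head hik (.head hkj (.single hjh))
  have : Std.Symm fun j k => inner ℂ (a j) (a k) ≠ 0 :=
    ⟨fun j k hjk => by rwa [Ne, inner_eq_zero_symm]⟩
  exact fun i j => (hub i).trans (symm (hub j))

theorem overlapConnected_party (p : Fin 3) :
    OverlapConnected fun i => (basisIIFactors i p).vec := by
  refine .of_hub (h := .inr 1) fun i => ?_
  obtain ⟨j, hj, hij⟩ := overlaps_path_party p i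
  refine ⟨j, j, inner_vec_ne_zero hij, ?_, inner_vec_ne_zero ?_⟩
  · rw [Ne, inner_self_eq_zero, ← norm_eq_zero, LocalState.norm_vec]
    exact one_ne_zero
  · fin_cases p <;> exact hj

theorem overlapConnected_others (p : Fin 3) : OverlapConnected fun i =>
    tensorVec fun q : {q : Fin 3 // q ≠ p} => (basisIIFactors i q).vec := by
  have key : ∀ i j, (∀ q, q ≠ p → (basisIIFactors i q).overlaps (basisIIFactors j q) = true) →
      inner ℂ (tensorVec fun q : {q : Fin 3 // q ≠ p} => (basisIIFactors i q).vec)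
        (tensorVec fun q : {q : Fin 3 // q ≠ p} => (basisIIFactors j q).vec) ≠ 0 :=
    fun i j h => by
      rw [inner_tensorVec]
      exact Finset.prod_ne_zero_iff.2 fun q _ => inner_vec_ne_zero (h q q.2)
  refine .of_hub (h := .inr 1) fun i => ?_
  obtain ⟨j, hj, k, hkj, hik⟩ := overlaps_path_others p i
  refine ⟨j, k, key _ _ hik, key _ _ hkj, key _ _ fun q hq => ?_⟩
  have := hj q hq
  fin_cases q <;> exact this

theorem cut_basisII (p : Fin 3) (i : (Fin 6 × ℤˣ × ℤˣ) ⊕ Fin 3) :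
    cut p (basisII i) = prodVec (basisIIFactors i p).vec
      (tensorVec fun q : {q : Fin 3 // q ≠ p} => (basisIIFactors i q).vec) := by
  rw [basisII_eq_tensorVec, cut_tensorVec]

theorem eq_smul_one_of_party (p : Fin 3) (X : Matrix (Fin 3) (Fin 3) ℂ)
    (hX : ∀ j k, j ≠ k → inner ℂ (cut p (basisII j)) (actFst X (cut p (basisII k))) = 0) :
    ∃ c : ℂ, X = c • (1 : Matrix (Fin 3) (Fin 3) ℂ) :=
  exists_eq_smul_one_of_actFst (orthonormal_cut orthonormal_basisII p)
    (span_range_cut span_basisII p) (cut_basisII p) (overlapConnected_party p) X hX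

theorem isTrivial_of_isOrthogonalityPreserving (p : Fin 3) (M : Measurement 3)
    (hM : M.IsOrthogonalityPreserving p basisII) : M.IsTrivial := fun m =>
  eq_smul_one_of_party p _ fun j k hjk => by
    rw [Measurement.effect, actFst_mul, ← inner_actFst]
    exact hM m j k hjk

theorem isLocallyIrreducible_basisII : IsLocallyIrreducible basisII := by
  rintro p M hM ⟨m, j, k, hj, hk⟩
  obtain ⟨c, hc⟩ := isTrivial_of_isOrthogonalityPreserving p M hM m
  have hnorm : ∀ i, inner ℂ (M.post p m (basisII i)) (M.post p m (basisII i)) = c := fun i => by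
    rw [Measurement.post, inner_actFst, ← actFst_mul]
    change inner ℂ _ (actFst (M.effect m) _) = c
    rw [hc, actFst_smul, actFst_one, inner_smul_right, inner_cut, inner_self_eq_norm_sq_to_K,
      orthonormal_basisII.1 i]
    simp
  refine hk (inner_self_eq_zero (𝕜 := ℂ).1 ?_)
  rw [hnorm k, ← hnorm j, hj, inner_zero_left]

theorem proposition3 :
    IsTypeII basisII ∧
      ∀ (p : Fin 3) (M : Measurement 3), M.IsOrthogonalityPreserving p basisII → M.IsTrivial := by
  refine ⟨⟨⟨⟨fun i => ?_, orthonormal_basisII, span_basisII⟩, fun p => ?_⟩,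
    isLocallyIrreducible_basisII⟩, isTrivial_of_isOrthogonalityPreserving⟩
  · rcases i with ⟨g, s, t⟩ | k
    · fin_cases g <;> exact ⟨_, _, _, rfl⟩
    · exact ⟨_, _, _, rfl⟩
  · have : Nontrivial ((Fin 6 × ℤˣ × ℤˣ) ⊕ Fin 3) := ⟨.inr 0, .inr 1, by simp⟩
    exact not_LOCCDistinguishable (orthonormal_cut orthonormal_basisII p)
      (eq_smul_one_of_party p) fun Y hY =>
        exists_eq_smul_one_of_actSnd (orthonormal_cut orthonormal_basisII p)
          (span_range_cut span_basisII p) (cut_basisII p) (overlapConnected_others p) Y hY
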